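/- Let $G$ be a connected (real, finite-dimensional) Lie group with left Haar measure $dg$. Let $X$ be a connected Hausdorff $G$-space, i.e. a connected Hausdorff topological space with a left $G$-action for which the action map $G \times X \to X$ is continuous, and let $\mu$ be a $G$-invariant Borel probability measure on $X$ of full support (every nonempty open subset of $X$ has positive measure). Assume that $(X,\mu)$ has the qualitative Sobolev embedding property: there exist $1 \leq p < q \leq \infty$ and a nonnegative continuous function $\varphi \in L^1(G)$, not identically zero, such that for every complex-valued $f \in L^p(X,\mu)$ the convolution $$(\varphi \ast f)(x) = \int_G \varphi(g)\, f(g^{-1}x)\, dg$$ lies in $L^q(X,\mu)$. Then there is a closed cocompact subgroup $H \subseteq G$ (i.e. $H$ is closed and $H \backslash G$ is compact) such that $X \simeq H \backslash G$ as $G$-spaces, i.e. there is a $G$-equivariant homeomorphism $X \to H \backslash G$, where $H\backslash G$ is the space of right cosets $Hx$ with the quotient topology and the action $g \cdot Hx = Hxg^{-1}$. -/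

import Mathlib

open scoped Manifold ContDiff

/-- The space `H \ G` of right cosets `H x` of a subgroup `H` of `G`. -/
def RightCosetSpace {G : Type*} [Group G] (H : Subgroup G) : Type _ :=
  Quotient (QuotientGroup.rightRel H)

namespace RightCosetSpace

/-- The projection `x ↦ H x` from `G` to `H \ G`. -/
def mk {G : Type*} [Group G] (H : Subgroup G) (x : G) : RightCosetSpace H :=
  Quotient.mk (QuotientGroup.rightRel H) x

theorem mk_eq_mk_iff {G : Type*} [Group G] {H : Subgroup G} {x y : G} :
    mk H x = mk H y ↔ y * x⁻¹ ∈ H :=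
  Quotient.eq.trans QuotientGroup.rightRel_apply

/-- The quotient topology on `H \ G`. -/
instance {G : Type*} [Group G] [TopologicalSpace G] (H : Subgroup G) :
    TopologicalSpace (RightCosetSpace H) :=
  inferInstanceAs (TopologicalSpace (Quotient (QuotientGroup.rightRel H)))

/-- The action of `G` on `H \ G` by right translation, written as a left action:
`g • (H x) = H (x g⁻¹)`. -/
instance {G : Type*} [Group G] (H : Subgroup G) : MulAction G (RightCosetSpace H) where
  smul g := Quotient.map (fun x => x * g⁻¹) (fun x y h => by
    have h' : y * x⁻¹ ∈ H := QuotientGroup.rightRel_apply.1 h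
    refine QuotientGroup.rightRel_apply.2 ?_
    simpa [mul_assoc] using h')
  one_smul := by
    intro a
    induction a using Quotient.inductionOn with
    | h x => exact congrArg (mk H) (by simp)
  mul_smul := by
    intro g g' a
    induction a using Quotient.inductionOn with
    | h x => exact congrArg (mk H) (by simp [mul_assoc])

theorem smul_mk {G : Type*} [Group G] (H : Subgroup G) (g x : G) :
    g • mk H x = mk H (x * g⁻¹) := rfl

end RightCosetSpace

/-- The convolution `(φ ∗ f)(x) = ∫_G φ(g) f(g⁻¹ x) dg` of a real function `φ` on `G` with a
complex function `f` on a space on which `G` acts; `ν` is the measure `dg` on `G`. -/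
noncomputable def orbitConvolution {G X : Type*} [Group G] [MeasurableSpace G] [MulAction G X]
    (ν : MeasureTheory.Measure G) (φ : G → ℝ) (f : X → ℂ) (x : X) : ℂ :=
  ∫ g, (φ g : ℂ) * f (g⁻¹ • x) ∂ν

/-- The qualitative Sobolev embedding property of `(X, μ)`, where `ν` is a Haar measure on `G`:
for some `1 ≤ p < q ≤ ∞` and some nonnegative continuous integrable `φ ≢ 0` on `G`, convolution
with `φ` maps `L^p(X, μ)` into `L^q(X, μ)`. -/
def QualitativeSobolevEmbedding {G X : Type*} [Group G] [TopologicalSpace G] [MeasurableSpace G]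
    [MulAction G X] [MeasurableSpace X]
    (ν : MeasureTheory.Measure G) (μ : MeasureTheory.Measure X) : Prop :=
  ∃ (p q : ENNReal) (φ : G → ℝ), 1 ≤ p ∧ p < q ∧
    Continuous φ ∧ MeasureTheory.Integrable φ ν ∧ (∀ g, 0 ≤ φ g) ∧ (∃ g, φ g ≠ 0) ∧
    ∀ f : X → ℂ, MeasureTheory.MemLp f p μ →
      MeasureTheory.MemLp (orbitConvolution ν φ f) q μ

/-! A gliding-hump argument makes the embedding quantitative on open sets: `ε * μ(A)^(1/q) ≤
μ(S)^(1/p)` whenever `S` contains a suitable thickening of `A` (`exists_mul_rpow_measureReal_le`).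
For a compact neighborhood `W` of `1`, invariance bounds `μ(W²A)` by `k * μ(WA)`. Testing on `WA`
and `W²A`, the strict inequality `1/q < 1/p` bounds `μ(WA)` below, uniformly in `A`. As `μ` has mass
1, only boundedly many sets `Wx` can be pairwise disjoint, so finitely many `W⁻¹Wy` cover `X`. Hence
`X` is compact and orbits are clopen; connectedness leaves one orbit, and Baire category makes the
orbit map open. -/

open MeasureTheory Set Filter Topology
open scoped Pointwise

/-! ### From the qualitative embedding to a quantitative bound. -/

section Convolution

variable {G X : Type*} [Group G] [TopologicalSpace G] [IsTopologicalGroup G]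
  [SecondCountableTopology G] [MeasurableSpace G] [BorelSpace G]
  {ν : Measure G} [SigmaFinite ν] [TopologicalSpace X] [MulAction G X] [ContinuousSMul G X]
  [MeasurableSpace X] [BorelSpace X] {μ : Measure X} [IsProbabilityMeasure μ]
  [SMulInvariantMeasure G X μ]

omit [IsProbabilityMeasure μ] in
theorem measurePreserving_fst_inv_smul [SFinite μ] :
    MeasurePreserving (fun z : G × X => (z.1, z.1⁻¹ • z.2)) (ν.prod μ) (ν.prod μ) := by
  have hcont : Continuous (fun z : G × X => z.1⁻¹ • z.2) := by fun_prop
  exact (MeasurePreserving.id ν).skew_product (g := fun g x => g⁻¹ • x) hcont.measurable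
    (Eventually.of_forall fun g => (measurePreserving_smul g⁻¹ μ).map_eq)

/-- Bounds on an `L^p` function hold only almost everywhere; by Fubini and invariance they survive
along almost every orbit. -/
theorem ae_ae_inv_smul {P : X → Prop} (h : ∀ᵐ x ∂μ, P x) :
    ∀ᵐ x ∂μ, ∀ᵐ g ∂ν, P (g⁻¹ • x) := by
  have h1 : ∀ᵐ z ∂(ν.prod μ), P (z.1⁻¹ • z.2) :=
    (Measure.quasiMeasurePreserving_snd.comp
      measurePreserving_fst_inv_smul.quasiMeasurePreserving).ae h
  have h2 : ∀ᵐ z ∂(μ.prod ν), P (z.2⁻¹ • z.1) :=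
    (Measure.measurePreserving_swap (μ := μ) (ν := ν)).quasiMeasurePreserving.ae h1
  exact Measure.ae_ae_of_ae_prod h2

theorem ae_integrable_mul_inv_smul {φ : G → ℝ} {F : X → ℝ} (hφ : Integrable φ ν)
    (hF : Integrable F μ) : ∀ᵐ x ∂μ, Integrable (fun g => φ g * F (g⁻¹ • x)) ν := by
  have h1 : Integrable (fun z : G × X => φ z.1 * F (z.1⁻¹ • z.2)) (ν.prod μ) :=
    (measurePreserving_fst_inv_smul (ν := ν) (μ := μ)).integrable_comp_of_integrable
      (hφ.mul_prod hF)
  exact h1.prod_left_ae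

/-- Pointwise lower bound for the convolution of `φ` with a function that dominates a multiple
of an indicator function. -/
theorem ae_le_norm_orbitConvolution {φ : G → ℝ} (hφ : Integrable φ ν) (hφ0 : ∀ g, 0 ≤ φ g)
    {K : Set G} (hK : MeasurableSet K) (hKfin : ν K ≠ ⊤) {c : ℝ} (hcK : ∀ g ∈ K, c ≤ φ g)
    {F : X → ℝ} (hF : Integrable F μ) (hF0 : ∀ᵐ x ∂μ, 0 ≤ F x)
    {w : ℝ} (hw : 0 ≤ w) {S : Set X} (hFS : ∀ᵐ x ∂μ, x ∈ S → w ≤ F x)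
    {B : Set X} (hB : ∀ g ∈ K, ∀ x ∈ B, g⁻¹ • x ∈ S) :
    ∀ᵐ x ∂μ, x ∈ B → c * w * ν.real K ≤ ‖orbitConvolution ν φ (fun x => (F x : ℂ)) x‖ := by
  filter_upwards [ae_integrable_mul_inv_smul hφ hF, ae_ae_inv_smul (ν := ν) hF0,
    ae_ae_inv_smul (ν := ν) hFS] with x hint h0 hS hxB
  have hconv : orbitConvolution ν φ (fun x => (F x : ℂ)) x
      = ((∫ g, φ g * F (g⁻¹ • x) ∂ν : ℝ) : ℂ) := by
    rw [orbitConvolution, ← integral_complex_ofReal]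
    simp
  rw [hconv, Complex.norm_real]
  refine le_trans ?_ (le_abs_self _)
  have hcst : ∫ g, K.indicator (fun _ => c * w) g ∂ν = c * w * ν.real K := by
    rw [integral_indicator_const _ hK, smul_eq_mul, mul_comm]
  rw [← hcst]
  refine integral_mono_ae ((integrable_indicator_iff hK).2 (integrableOn_const hKfin)) hint ?_
  filter_upwards [h0, hS] with g hg0 hgS
  by_cases hg : g ∈ K
  · rw [indicator_of_mem hg]
    exact (mul_le_mul_of_nonneg_right (hcK g hg) hw).trans
      (mul_le_mul_of_nonneg_left (hgS (hB g hg x hxB)) (hφ0 g))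
  · rw [indicator_of_notMem hg]
    exact mul_nonneg (hφ0 g) hg0

-- Chebyshev's inequality. For `q = ⊤` the exponent is `1 / 0 = 0`, and the bound is the essential
-- supremum one, which needs `μ B ≠ 0`.
omit [TopologicalSpace X] [BorelSpace X] [IsProbabilityMeasure μ] in
theorem mul_rpow_measureReal_le_toReal_eLpNorm {f : X → ℂ} {q : ENNReal} (hq : q ≠ 0)
    (hf : MemLp f q μ) {B : Set X} (hB : MeasurableSet B) (hB0 : μ B ≠ 0) {a : ℝ} (ha : 0 ≤ a)
    (h : ∀ᵐ x ∂μ, x ∈ B → a ≤ ‖f x‖) :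
    a * μ.real B ^ (1 / q.toReal) ≤ (eLpNorm f q μ).toReal := by
  have h1 : eLpNorm (B.indicator fun _ => a) q μ ≤ eLpNorm f q μ := by
    refine eLpNorm_mono_ae ?_
    filter_upwards [h] with x hx
    by_cases hxB : x ∈ B
    · simpa [hxB, abs_of_nonneg ha] using hx hxB
    · simp [hxB]
  have h2 := ENNReal.toReal_mono hf.2.ne h1
  rw [eLpNorm_indicator_const' hB hB0 hq, ENNReal.toReal_mul, ← ENNReal.toReal_rpow] at h2
  simpa [abs_of_nonneg ha, Measure.real] using h2

omit [TopologicalSpace X] [BorelSpace X] in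
/-- If the `L^p` norms `w n * μ (S n) ^ (1 / p)` are summable, some nonnegative function in `L^p`
is at least `w n` on `S n` for every `n`. -/
theorem exists_memLp_dominating {p : ENNReal} (hp : 1 ≤ p) {S : ℕ → Set X}
    (hS : ∀ n, MeasurableSet (S n)) {w : ℕ → ℝ} (hw : ∀ n, 0 ≤ w n)
    (hsum : Summable fun n => w n * μ.real (S n) ^ (1 / p.toReal)) :
    ∃ F : X → ℝ, MemLp F p μ ∧ (∀ᵐ x ∂μ, 0 ≤ F x) ∧ ∀ n, ∀ᵐ x ∂μ, x ∈ S n → w n ≤ F x := by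
  have : Fact (1 ≤ p) := ⟨hp⟩
  let u : ℕ → Lp ℝ p μ := fun n => indicatorConstLp p (hS n) (measure_ne_top μ _) (w n)
  have hu0 : ∀ n, 0 ≤ u n := by
    intro n
    rw [← Lp.coeFn_nonneg]
    filter_upwards [indicatorConstLp_coeFn (p := p) (hs := hS n)
      (hμs := measure_ne_top μ _) (c := w n)] with x hx
    rw [hx]
    exact indicator_nonneg (fun _ _ => hw n) x
  have hus : Summable u := by
    refine Summable.of_norm_bounded hsum fun n => ?_
    refine norm_indicatorConstLp_le.trans_eq ?_
    rw [Real.norm_of_nonneg (hw n)]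
  refine ⟨(∑' n, u n : Lp ℝ p μ), Lp.memLp _, ?_, fun n => ?_⟩
  · exact (Lp.coeFn_nonneg _).2 (tsum_nonneg hu0)
  · have hle : u n ≤ ∑' n, u n := hus.le_tsum n fun j _ => hu0 j
    filter_upwards [(Lp.coeFn_le _ _).2 hle, indicatorConstLp_coeFn_mem (p := p) (hs := hS n)
      (hμs := measure_ne_top μ _) (c := w n)] with x hx hx' hxS
    rw [← hx' hxS]
    exact hx

/-- The quantitative consequence of `L^p`-`L^q` improvement, tested on indicator functions. -/
theorem exists_mul_rpow_measureReal_le [μ.IsOpenPosMeasure] {p q : ENNReal} (hp : 1 ≤ p)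
    (hq : q ≠ 0) {φ : G → ℝ} (hφ : Integrable φ ν) (hφ0 : ∀ g, 0 ≤ φ g)
    (hconv : ∀ f : X → ℂ, MemLp f p μ → MemLp (orbitConvolution ν φ f) q μ)
    {K : Set G} (hK : MeasurableSet K) (hKfin : ν K ≠ ⊤) (hK0 : ν K ≠ 0)
    {c : ℝ} (hc : 0 < c) (hcK : ∀ g ∈ K, c ≤ φ g) (g₀ : G) :
    ∃ ε : ℝ, 0 < ε ∧ ∀ A S : Set X, IsOpen A → A.Nonempty → IsOpen S → S.Nonempty →
      (∀ g ∈ K, ∀ x ∈ A, (g⁻¹ * g₀) • x ∈ S) →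
      ε * μ.real A ^ (1 / q.toReal) ≤ μ.real S ^ (1 / p.toReal) := by
  by_contra! hcon
  -- Humps of `L^p` norm `2⁻ⁿ` are summable, while failure of the bound at `4⁻ⁿ` forces the
  -- convolution to have `L^q` norm at least a constant times `2ⁿ`.
  choose A S hA hAne hS hSne hKA hlt using fun n : ℕ => hcon ((1 / 4 : ℝ) ^ n) (by positivity)
  have hSpos : ∀ n, 0 < μ.real (S n) := fun n =>
    ENNReal.toReal_pos ((hS n).measure_pos μ (hSne n)).ne' (measure_ne_top μ _)
  have hKpos : 0 < ν.real K := ENNReal.toReal_pos hK0 hKfin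
  set s : ℕ → ℝ := fun n => μ.real (S n) ^ (1 / p.toReal)
  have hspos : ∀ n, 0 < s n := fun n => Real.rpow_pos_of_pos (hSpos n) _
  obtain ⟨F, hFp, hF0, hF⟩ := exists_memLp_dominating (μ := μ) hp (fun n => (hS n).measurableSet)
    (w := fun n => (1 / 2 : ℝ) ^ n / s n) (fun n => by have := hspos n; positivity) (by
      refine summable_geometric_two.congr fun n => ?_
      exact (div_mul_cancel₀ _ (hspos n).ne').symm)
  have hM := hconv _ hFp.ofReal
  set M := (eLpNorm (orbitConvolution ν φ fun x => (F x : ℂ)) q μ).toReal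
  have key : ∀ n : ℕ, c * ν.real K * 2 ^ n ≤ M := by
    intro n
    have hw : 0 ≤ (1 / 2 : ℝ) ^ n / s n := by have := hspos n; positivity
    have h1 := ae_le_norm_orbitConvolution hφ hφ0 hK hKfin hcK (hFp.integrable hp) hF0 hw (hF n)
      (B := g₀ • A n) (by
        rintro g hg _ ⟨x, hx, rfl⟩
        have := hKA n g hg x hx
        rwa [mul_smul] at this)
    have hmeas : μ (g₀ • A n) = μ (A n) := measure_smul μ g₀ (A n)
    have h2 := mul_rpow_measureReal_le_toReal_eLpNorm hq hM ((hA n).smul g₀).measurableSet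
      (by rw [hmeas]; exact ((hA n).measure_pos μ (hAne n)).ne') (by positivity) h1
    rw [show μ.real (g₀ • A n) = μ.real (A n) from congrArg ENNReal.toReal hmeas] at h2
    refine le_trans ?_ h2
    have h3 : (1 / 2 : ℝ) ^ n * 2 ^ n = 1 := by rw [← mul_pow]; norm_num
    have h4 : (1 / 4 : ℝ) ^ n = (1 / 2) ^ n * (1 / 2) ^ n := by rw [← mul_pow]; norm_num
    have h5 : 2 ^ n ≤ (1 / 2 : ℝ) ^ n / s n * μ.real (A n) ^ (1 / q.toReal) := by
      rw [div_mul_eq_mul_div, le_div_iff₀ (hspos n)]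
      have h6 := mul_le_mul_of_nonneg_left (hlt n).le (show (0 : ℝ) ≤ 2 ^ n by positivity)
      refine h6.trans_eq ?_
      rw [h4]
      linear_combination (1 / 2 : ℝ) ^ n * μ.real (A n) ^ (1 / q.toReal) * h3
    calc c * ν.real K * 2 ^ n
        ≤ c * ν.real K * ((1 / 2 : ℝ) ^ n / s n * μ.real (A n) ^ (1 / q.toReal)) :=
          mul_le_mul_of_nonneg_left h5 (by positivity)
      _ = _ := by ring
  have hpos : 0 < c * ν.real K := by positivity
  obtain ⟨n, hn⟩ := pow_unbounded_of_one_lt (M / (c * ν.real K)) (one_lt_two (α := ℝ))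
  rw [div_lt_iff₀ hpos, mul_comm] at hn
  exact absurd (key n) (not_le.2 hn)

end Convolution

/-! ### Packing, compactness and transitivity. -/

section Transitivity

variable {G X : Type*} [Group G] [TopologicalSpace G] [IsTopologicalGroup G]
  [TopologicalSpace X] [T2Space X] [MulAction G X] [ContinuousSMul G X]

omit [IsTopologicalGroup G] [T2Space X] in
theorem exists_isOpen_smul_subset {W : Set G} (hW : IsCompact W) {x : X} {O : Set X}
    (hO : O ∈ 𝓝ˢ (W • {x})) : ∃ A : Set X, IsOpen A ∧ x ∈ A ∧ W • A ⊆ O := by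
  obtain ⟨O', hO', hsub, hO'O⟩ := mem_nhdsSet_iff_exists.1 hO
  obtain ⟨u, v, -, hv, hu', hxv, huv⟩ := generalized_tube_lemma (n := {z : G × X | z.1 • z.2 ∈ O'})
    hW (isCompact_singleton (x := x)) (hO'.preimage (by fun_prop))
    (by rintro ⟨g, y⟩ ⟨hg, rfl⟩; exact hsub (smul_mem_smul hg rfl))
  refine ⟨v, hv, hxv rfl, ?_⟩
  rintro _ ⟨g, hg, y, hy, rfl⟩
  exact hO'O (huv (mk_mem_prod (hu' hg) hy))

omit [IsTopologicalGroup G] in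
/-- If the `W`-thickenings of nonempty open sets have measure bounded below, then `X` is covered
by finitely many translates of a compact subset of `G`. -/
theorem exists_finset_forall_mem_inv_mul_smul [MeasurableSpace X] [BorelSpace X] {μ : Measure X}
    [IsProbabilityMeasure μ] {W : Set G} (hW : IsCompact W) {δ : ℝ} (hδ : 0 < δ)
    (hWδ : ∀ A : Set X, IsOpen A → A.Nonempty → δ ≤ μ.real (W • A)) :
    ∃ s : Finset X, ∀ x : X, ∃ y ∈ s, x ∈ (W⁻¹ * W) • ({y} : Set X) := by
  have bound : ∀ s : Finset X, (s : Set X).PairwiseDisjoint (fun x => W • ({x} : Set X)) →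
      s.card * δ ≤ 1 := by
    intro s hs
    -- The measure bound concerns open sets, so the disjoint compact sets `Wx` are first enlarged to
    -- disjoint open thickenings.
    have hdis : (s : Set X).PairwiseDisjoint (fun x => 𝓝ˢ (W • ({x} : Set X))) := by
      intro x hx y hy hxy
      have hc : ∀ z : X, IsCompact (W • ({z} : Set X)) := fun z => hW.smul_set isCompact_singleton
      exact (SeparatedNhds.of_isCompact_isCompact (hc x) (hc y) (hs hx hy hxy)).disjoint_nhdsSet
    obtain ⟨O, hO, hOdis⟩ := hdis.exists_mem_filter s.finite_toSet
    choose A hA hxA hAO using fun x => exists_isOpen_smul_subset hW (hO x)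
    have hopen : ∀ x, IsOpen (W • A x) := fun x => (hA x).smul_left
    have h1 : μ.real (⋃ x ∈ s, W • A x) = ∑ x ∈ s, μ.real (W • A x) :=
      measureReal_biUnion_finset (fun x hx y hy hxy => (hOdis hx hy hxy).mono (hAO x) (hAO y))
        fun x _ => (hopen x).measurableSet
    calc (s.card : ℝ) * δ = ∑ x ∈ s, δ := by simp
      _ ≤ ∑ x ∈ s, μ.real (W • A x) := Finset.sum_le_sum fun x _ => hWδ _ (hA x) ⟨x, hxA x⟩
      _ ≤ 1 := h1 ▸ measureReal_le_one
  by_contra! hcon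
  -- A point outside every `W⁻¹Wy` has `Wx` disjoint from every `Wy`, so a packing can always be
  -- extended.
  have hex : ∀ n : ℕ, ∃ s : Finset X, s.card = n ∧
      (s : Set X).PairwiseDisjoint (fun x => W • ({x} : Set X)) := by
    classical
    intro n
    induction n with
    | zero => exact ⟨∅, rfl, by simp⟩
    | succ n ih =>
      obtain ⟨s, hsn, hs⟩ := ih
      obtain ⟨x, hx⟩ := hcon s
      have hne : W.Nonempty := by
        by_contra hWe
        have := hWδ univ isOpen_univ ⟨x, trivial⟩
        rw [not_nonempty_iff_eq_empty.1 hWe] at this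
        simp at this
        linarith
      obtain ⟨g, hg⟩ := hne
      have hxs : x ∉ s := fun h =>
        hx x h ⟨g⁻¹ * g, mul_mem_mul (inv_mem_inv.2 hg) hg, x, rfl, by simp⟩
      refine ⟨insert x s, by rw [Finset.card_insert_of_notMem hxs, hsn], ?_⟩
      rw [Finset.coe_insert, pairwiseDisjoint_insert_of_notMem (by simpa using hxs)]
      refine ⟨hs, fun y hy => disjoint_left.2 ?_⟩
      rintro _ ⟨a, ha, _, rfl, rfl⟩ ⟨b, hb, _, rfl, hab⟩
      refine hx _ hy ⟨a⁻¹ * b, mul_mem_mul (inv_mem_inv.2 ha) hb, _, rfl, ?_⟩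
      simp only at hab ⊢
      rw [mul_smul, hab, inv_smul_smul]
  obtain ⟨n, hn⟩ := exists_nat_gt (1 / δ)
  obtain ⟨s, rfl, hs⟩ := hex n
  rw [div_lt_iff₀ hδ] at hn
  exact absurd (bound s hs) (not_le.2 hn)

variable [ConnectedSpace X] {C : Set G} {s : Finset X}

omit [IsTopologicalGroup G] [T2Space X] [ConnectedSpace X] in
theorem compactSpace_of_forall_mem_smul (hC : IsCompact C)
    (hs : ∀ x : X, ∃ y ∈ s, x ∈ C • ({y} : Set X)) : CompactSpace X := by
  refine ⟨?_⟩
  have : (univ : Set X) = ⋃ y ∈ s, C • ({y} : Set X) := by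
    ext x
    simpa using hs x
  rw [this]
  exact s.isCompact_biUnion fun y _ => hC.smul_set isCompact_singleton

omit [TopologicalSpace G] [IsTopologicalGroup G] [TopologicalSpace X] [T2Space X]
  [ContinuousSMul G X] [ConnectedSpace X] in
theorem smul_mem_orbit_iff {g : G} {x y : X} :
    g • y ∈ MulAction.orbit G x ↔ y ∈ MulAction.orbit G x := by
  rw [← MulAction.orbit_eq_iff, MulAction.orbit_smul, MulAction.orbit_eq_iff]

omit [IsTopologicalGroup G] in
/-- On a connected space finitely many compact orbits that cover are a single orbit. -/
theorem isPretransitive_of_forall_mem_smul (hC : IsCompact C)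
    (hs : ∀ x : X, ∃ y ∈ s, x ∈ C • ({y} : Set X)) : MulAction.IsPretransitive G X := by
  classical
  have hclosed : ∀ t : Finset X, IsClosed (⋃ y ∈ t, C • ({y} : Set X)) := fun t =>
    (t.isCompact_biUnion fun y _ => hC.smul_set isCompact_singleton).isClosed
  have key : ∀ x : X, MulAction.orbit G x = univ := by
    intro x
    have h1 : MulAction.orbit G x = ⋃ y ∈ s.filter (· ∈ MulAction.orbit G x), C • ({y} : Set X) := by
      ext z
      simp only [mem_iUnion, Finset.mem_filter, exists_prop]
      constructor
      · intro hz
        obtain ⟨y, hy, g, hg, _, rfl, rfl⟩ := hs z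
        exact ⟨_, ⟨hy, (smul_mem_orbit_iff).1 hz⟩, smul_mem_smul hg rfl⟩
      · rintro ⟨y, ⟨-, hy⟩, g, hg, _, rfl, rfl⟩
        exact (smul_mem_orbit_iff).2 hy
    have h2 : (MulAction.orbit G x)ᶜ
        = ⋃ y ∈ s.filter (· ∉ MulAction.orbit G x), C • ({y} : Set X) := by
      ext z
      simp only [mem_iUnion, Finset.mem_filter, exists_prop, mem_compl_iff]
      constructor
      · intro hz
        obtain ⟨y, hy, g, hg, _, rfl, rfl⟩ := hs z
        exact ⟨_, ⟨hy, fun h => hz ((smul_mem_orbit_iff).2 h)⟩, smul_mem_smul hg rfl⟩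
      · rintro ⟨y, ⟨-, hy⟩, g, hg, _, rfl, rfl⟩ h
        exact hy ((smul_mem_orbit_iff).1 h)
    have hclopen : IsClopen (MulAction.orbit G x) :=
      ⟨h1 ▸ hclosed _, isClosed_compl_iff.1 (h2 ▸ hclosed _)⟩
    exact hclopen.eq_univ (MulAction.nonempty_orbit x)
  exact ⟨fun x y => (key x).ge (mem_univ y)⟩

end Transitivity

/-! ### Transitive spaces as coset spaces. -/

namespace RightCosetSpace

variable {G X : Type*} [Group G] [TopologicalSpace G] [IsTopologicalGroup G]
  [TopologicalSpace X] [MulAction G X]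

/-- A transitive `G`-space with an open continuous orbit map is equivariantly homeomorphic to
the space of right cosets of a stabilizer. -/
theorem exists_homeomorph_stabilizer [MulAction.IsPretransitive G X] [ContinuousSMul G X] (x₀ : X)
    (hopen : IsOpenMap fun g : G => g • x₀) :
    ∃ e : X ≃ₜ RightCosetSpace (MulAction.stabilizer G x₀),
      ∀ (g : G) (x : X), e (g • x) = g • e x := by
  set H := MulAction.stabilizer G x₀ with hH
  have hiff : ∀ g h : G, mk H g = mk H h ↔ g⁻¹ • x₀ = h⁻¹ • x₀ := by
    intro g h
    rw [mk_eq_mk_iff, hH, MulAction.mem_stabilizer_iff, mul_smul, smul_eq_iff_eq_inv_smul]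
  -- The inverse turns right translation by `g⁻¹` on cosets into the left action of `g`.
  let f : RightCosetSpace H → X :=
    Quotient.lift (fun g : G => g⁻¹ • x₀) fun g h hgh => (hiff g h).1 (Quotient.sound hgh)
  have hf : ∀ g, f (mk H g) = g⁻¹ • x₀ := fun _ => rfl
  have hmk : ∀ z, ∃ g, mk H g = z := fun z => Quotient.exists_rep z
  have hcmk : Continuous (mk H) := continuous_quotient_mk'
  have hfcont : Continuous f :=
    Continuous.quotient_lift (by fun_prop : Continuous fun g : G => g⁻¹ • x₀) _
  have hfopen : IsOpenMap f := by
    intro U hU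
    have : f '' U = (fun g : G => g • x₀) '' ((mk H ⁻¹' U)⁻¹) := by
      ext x
      constructor
      · rintro ⟨z, hz, rfl⟩
        obtain ⟨g, rfl⟩ := hmk z
        exact ⟨g⁻¹, by simpa using hz, (hf g).symm⟩
      · rintro ⟨g, hg, rfl⟩
        exact ⟨mk H g⁻¹, hg, by simp [hf]⟩
    rw [this]
    exact hopen _ (hU.preimage hcmk).inv
  have hbij : Function.Bijective f := by
    constructor
    · intro a b hab
      obtain ⟨g, rfl⟩ := hmk a
      obtain ⟨h, rfl⟩ := hmk b
      exact (hiff g h).2 hab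
    · intro x
      obtain ⟨g, rfl⟩ := MulAction.exists_smul_eq G x₀ x
      exact ⟨mk H g⁻¹, by simp [hf]⟩
  let e := (Equiv.ofBijective f hbij).toHomeomorphOfContinuousOpen hfcont hfopen
  refine ⟨e.symm, fun g x => ?_⟩
  rw [Homeomorph.symm_apply_eq]
  obtain ⟨z, rfl⟩ := e.surjective x
  obtain ⟨h, rfl⟩ := hmk z
  rw [Homeomorph.symm_apply_apply, smul_mk]
  change g • f (mk H h) = f (mk H (h * g⁻¹))
  simp [hf, mul_smul]

end RightCosetSpace

/-- Thickenings of a set by a compact set and by a neighborhood of `1` have comparable measure. -/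
theorem exists_measureReal_le_mul {G X : Type*} [Group G] [TopologicalSpace G]
    [IsTopologicalGroup G] [MulAction G X] [MeasurableSpace X] (μ : Measure X) [IsFiniteMeasure μ]
    [SMulInvariantMeasure G X μ] {W K : Set G} (hW : W ∈ 𝓝 1) (hK : IsCompact K) :
    ∃ k : ℝ, 0 < k ∧ ∀ A : Set X, μ.real (K • A) ≤ k * μ.real (W • A) := by
  obtain ⟨t, ht⟩ := compact_covered_by_mul_left_translates hK
    (⟨1, mem_interior_iff_mem_nhds.2 hW⟩ : (interior W).Nonempty)
  -- The `+ 1` keeps the constant positive when the cover `t` is empty.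
  refine ⟨t.card + 1, by positivity, fun A => ?_⟩
  have hsub : K • A ⊆ ⋃ g ∈ t, g⁻¹ • (W • A) := by
    rintro _ ⟨k, hk, a, ha, rfl⟩
    obtain ⟨g, hg, hgk⟩ := mem_iUnion₂.1 (ht hk)
    refine mem_iUnion₂.2 ⟨g, hg, mem_inv_smul_set_iff.2 ?_⟩
    exact ⟨g * k, hgk, a, ha, mul_smul g k a⟩
  calc μ.real (K • A) ≤ μ.real (⋃ g ∈ t, g⁻¹ • (W • A)) := measureReal_mono hsub (measure_ne_top μ _)
    _ ≤ ∑ g ∈ t, μ.real (g⁻¹ • (W • A)) := measureReal_biUnion_finset_le _ _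
    _ = t.card * μ.real (W • A) := by
        simp [measureReal_def, measure_smul]
    _ ≤ (t.card + 1) * μ.real (W • A) := by
        have := measureReal_nonneg (μ := μ) (s := W • A)
        linarith

/-! ### Uniform lower bound for thickenings. -/

section Thickening

variable {G X : Type*} [Group G] [TopologicalSpace G] [IsTopologicalGroup G]
  [LocallyCompactSpace G] [T2Space G] [SecondCountableTopology G] [MeasurableSpace G] [BorelSpace G]
  (ν : Measure G) [ν.IsHaarMeasure]
  [TopologicalSpace X] [MulAction G X] [ContinuousSMul G X]
  [MeasurableSpace X] [BorelSpace X] (μ : Measure X) [IsProbabilityMeasure μ]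
  [SMulInvariantMeasure G X μ] [μ.IsOpenPosMeasure]

/-- Under the qualitative Sobolev embedding, some compact `W ⊆ G` thickens every nonempty open
set to a set of measure bounded below. -/
theorem QualitativeSobolevEmbedding.exists_le_measureReal_smul
    (h : QualitativeSobolevEmbedding ν μ) :
    ∃ W : Set G, IsCompact W ∧ ∃ δ : ℝ, 0 < δ ∧
      ∀ A : Set X, IsOpen A → A.Nonempty → δ ≤ μ.real (W • A) := by
  obtain ⟨p, q, φ, hp, hpq, hφc, hφ, hφ0, ⟨g₀, hg₀⟩, hconv⟩ := h
  have hφpos : 0 < φ g₀ := lt_of_le_of_ne (hφ0 g₀) (Ne.symm hg₀)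
  have hU : {g : G | φ g₀ / 2 < φ (g₀ * g⁻¹)} ∈ 𝓝 (1 : G) :=
    (isOpen_lt continuous_const (by fun_prop)).mem_nhds (by simp [hφpos])
  obtain ⟨W, hW1, hWU, hWc⟩ := local_compact_nhds hU
  -- Chosen so that `K⁻¹ * g₀` is `W`.
  set K : Set G := g₀ • W⁻¹
  have hKc : IsCompact K := hWc.inv.smul g₀
  have hKn : K ∈ 𝓝 g₀ := by
    have := smul_mem_nhds_smul g₀ (inv_mem_nhds_one G hW1)
    rwa [smul_eq_mul, mul_one] at this
  have hcK : ∀ g ∈ K, φ g₀ / 2 ≤ φ g := by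
    rintro _ ⟨v, hv, rfl⟩
    have hv' : φ g₀ / 2 < φ (g₀ * v⁻¹⁻¹) := hWU (mem_inv.1 hv)
    simpa using hv'.le
  obtain ⟨ε, hε, hbound⟩ := exists_mul_rpow_measureReal_le (μ := μ) hp
    (zero_lt_one.trans_le hp |>.trans hpq).ne' hφ hφ0 hconv hKc.measurableSet hKc.measure_ne_top
    (Measure.measure_pos_of_mem_nhds ν hKn).ne' (half_pos hφpos) hcK g₀
  obtain ⟨k, hk, hkW⟩ := exists_measureReal_le_mul μ hW1 (hWc.mul hWc)
  set a := 1 / p.toReal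
  set b := 1 / q.toReal with hb
  have hptop : p ≠ ⊤ := (hpq.trans_le le_top).ne
  have hp0 : 0 < p.toReal := ENNReal.toReal_pos (zero_lt_one.trans_le hp).ne' hptop
  have ha0 : 0 < a := by positivity
  have hab : b < a := by
    rcases eq_or_ne q ⊤ with rfl | hq
    · simpa [hb] using ha0
    · exact one_div_lt_one_div_of_lt hp0 ((ENNReal.toReal_lt_toReal hptop hq).2 hpq)
  -- With `m = μ(WA)`, this solves `ε * m^b ≤ k^a * m^a` for `m`.
  refine ⟨W, hWc, (ε / k ^ a) ^ (1 / (a - b)), by positivity, fun A hA hAne => ?_⟩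
  have h1W : (1 : G) ∈ W := mem_of_mem_nhds hW1
  have hAW : (W • A).Nonempty := Set.Nonempty.smul ⟨1, h1W⟩ hAne
  have hm : 0 < μ.real (W • A) := ENNReal.toReal_pos
    ((hA.smul_left (s := W)).measure_pos μ hAW).ne' (measure_ne_top μ _)
  have h1 := hbound (W • A) ((W * W) • A) hA.smul_left hAW hA.smul_left
    (Nonempty.smul ⟨1 * 1, mul_mem_mul h1W h1W⟩ hAne) (by
      rintro _ ⟨v, hv, rfl⟩ x hx
      rw [mul_smul W W A]
      refine smul_mem_smul ?_ hx
      simpa using mem_inv.1 hv)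
  have h2 : μ.real ((W * W) • A) ^ a ≤ k ^ a * μ.real (W • A) ^ a := by
    rw [← Real.mul_rpow hk.le hm.le]
    exact Real.rpow_le_rpow measureReal_nonneg (hkW A) ha0.le
  have h3 : ε / k ^ a ≤ μ.real (W • A) ^ (a - b) := by
    rw [Real.rpow_sub hm, div_le_div_iff₀ (by positivity) (by positivity)]
    linarith [h1.trans h2]
  have hab' : 0 < a - b := sub_pos.2 hab
  calc (ε / k ^ a) ^ (1 / (a - b)) ≤ (μ.real (W • A) ^ (a - b)) ^ (1 / (a - b)) :=
        Real.rpow_le_rpow (by positivity) h3 (by positivity)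
    _ = μ.real (W • A) := by
        rw [← Real.rpow_mul hm.le, mul_one_div_cancel hab'.ne', Real.rpow_one]

end Thickening

theorem theorem9p5
    {E : Type*} [NormedAddCommGroup E] [NormedSpace ℝ E] [FiniteDimensional ℝ E]
    {G : Type*} [Group G] [TopologicalSpace G] [ChartedSpace E G] [LieGroup 𝓘(ℝ, E) ∞ G]
    [T2Space G] [SecondCountableTopology G] [ConnectedSpace G]
    [MeasurableSpace G] [BorelSpace G]
    (ν : MeasureTheory.Measure G) [ν.IsHaarMeasure]
    {X : Type*} [TopologicalSpace X] [T2Space X] [ConnectedSpace X]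
    [MulAction G X] [ContinuousSMul G X]
    [MeasurableSpace X] [BorelSpace X]
    (μ : MeasureTheory.Measure X) [MeasureTheory.IsProbabilityMeasure μ]
    [MeasureTheory.SMulInvariantMeasure G X μ] [μ.IsOpenPosMeasure]
    (hSob : QualitativeSobolevEmbedding ν μ) :
    ∃ H : Subgroup G, IsClosed (H : Set G) ∧ CompactSpace (RightCosetSpace H) ∧
      ∃ e : X ≃ₜ RightCosetSpace H, ∀ (g : G) (x : X), e (g • x) = g • e x := by
  have : IsTopologicalGroup G := topologicalGroup_of_lieGroup 𝓘(ℝ, E) ∞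
  have : LocallyCompactSpace G := Manifold.locallyCompact_of_finiteDimensional 𝓘(ℝ, E)
  obtain ⟨W, hW, δ, hδ, hWδ⟩ := hSob.exists_le_measureReal_smul
  obtain ⟨s, hs⟩ := exists_finset_forall_mem_inv_mul_smul hW hδ hWδ
  have hC : IsCompact (W⁻¹ * W) := hW.inv.mul hW
  have : CompactSpace X := compactSpace_of_forall_mem_smul hC hs
  have : MulAction.IsPretransitive G X := isPretransitive_of_forall_mem_smul hC hs
  obtain ⟨x₀⟩ : Nonempty X := inferInstance
  -- The orbit map is open because `G` is σ-compact and the compact Hausdorff space `X` is Baire.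
  obtain ⟨e, he⟩ := RightCosetSpace.exists_homeomorph_stabilizer x₀
    (isOpenMap_smul_of_sigmaCompact (G := G) x₀)
  refine ⟨MulAction.stabilizer G x₀, ?_, e.compactSpace, e, he⟩
  exact isClosed_singleton.preimage (by fun_prop : Continuous fun g : G => g • x₀)
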